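/- **Theorem.** Let $x_1,\dots,x_n\in\mathbb{R}^D$ ($n\ge 1$), $y_1,\dots,y_n\in\{-1,1\}$, and let $$f(\theta)=\frac1n\sum_{i=1}^n\ln\bigl(1+\exp(-y_i\langle x_i,\theta\rangle)\bigr)$$ be the logistic regression objective. For $p\in[1,\infty]$ and $\theta^*\in\mathbb{R}^D$ suppose that the data are linearly separable by $\theta^*$ with normalized margin $$\gamma_p:=\min_{i}\frac{y_i\langle x_i,\theta^*\rangle}{\|\theta^*\|_p}>0$$ (for instance, $\theta^*$ may maximize this margin, and $p$ may be $1$). Consider deterministic Adam with constant step-size $\eta$, without bias correction, on $f$: $\theta_1=0$, $v_0=0$, $m_0=\nabla f(\theta_1)$ (or $m_0=0$; the result holds for both initializations), and for $t\ge 1$, with $g_t=\nabla f(\theta_t)$ and for every coordinate $j$, $$m_{t,j}=\beta_1m_{t-1,j}+(1-\beta_1)g_{t,j},\qquad v_{t,j}=\beta_2v_{t-1,j}+(1-\beta_2)g_{t,j}^2,\qquad \theta_{t+1,j}=\theta_{t,j}-\eta\,\frac{m_{t,j}}{\sqrt{v_{t,j}}}\qquad(0/0:=0),$$ where $0\le\beta_1\le\beta_2$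 and $0<\beta_2<1$. RMSProp is the case $\beta_1=0$. For all such $\beta_1,\beta_2$ and every $H\in\mathbb{R}$ there is a constant $C>0$, depending only on $\beta_1,\beta_2,H$, such that for all $n\ge1$ and $\gamma>0$ there is a step-size $\eta\in(0,C]$, depending only on $\beta_1,\beta_2,H,n,\gamma$ (in particular not on the target accuracy), with the following property. For every $p\in[1,\infty]$, every dimension $D$, all data as above with $\max_i\|x_i\|_1^2\le H$ and $\gamma_p=\gamma$, every $\varepsilon>0$, and every integer $T\ge 0$ with $$T\ \ge\ \frac{C}{\gamma_p^2}\left[n^2+\ln\left(\frac1{n\varepsilon}\right)\right],$$ Adam with the constant step-size $\eta$ satisfies $f(\theta_{T+1})\le\varepsilon$. -/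

import Mathlib

open scoped ENNReal

noncomputable section

/-- The logistic regression objective
`f(θ) = (1/n) ∑ᵢ ln (1 + exp (-yᵢ ⟨xᵢ, θ⟩))` with features `x i` and labels `y i`. -/
def logisticLoss {n D : ℕ} (x : Fin n → EuclideanSpace ℝ (Fin D)) (y : Fin n → ℝ)
    (θ : EuclideanSpace ℝ (Fin D)) : ℝ :=
  (1 / (n : ℝ)) * ∑ i, Real.log (1 + Real.exp (-(y i * inner ℝ (x i) θ)))

/-- The `ℓ_p` norm of a vector of `ℝ^D`, `p ∈ [1, ∞]`. -/
def lpNormVec {D : ℕ} (p : ℝ≥0∞) (θ : EuclideanSpace ℝ (Fin D)) : ℝ :=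
  ‖(WithLp.toLp p θ.ofLp : PiLp p (fun _ : Fin D => ℝ))‖

/-- The normalized margin `minᵢ yᵢ ⟨xᵢ, θ⟩ / ‖θ‖_p` of the data along the direction `θ`. -/
def normalizedMargin {n D : ℕ} (p : ℝ≥0∞) (x : Fin n → EuclideanSpace ℝ (Fin D))
    (y : Fin n → ℝ) (θ : EuclideanSpace ℝ (Fin D)) : ℝ :=
  ⨅ i, y i * inner ℝ (x i) θ / lpNormVec p θ

/-- The variables of Adam: iterate, first-moment estimate, second-moment estimate. -/
structure AdamState (D : ℕ) where
  θ : EuclideanSpace ℝ (Fin D)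
  m : EuclideanSpace ℝ (Fin D)
  v : EuclideanSpace ℝ (Fin D)

/-- One deterministic Adam iteration without bias correction. From `(θ_t, m_{t-1}, v_{t-1})` and
`g_t = ∇f(θ_t)` it computes, coordinatewise,
`m_t = β₁ m_{t-1} + (1-β₁) g_t`, `v_t = β₂ v_{t-1} + (1-β₂) g_t²` and
`θ_{t+1} = θ_t - η m_t / (√v_t + δ)`. -/
def adamStep {D : ℕ} (f : EuclideanSpace ℝ (Fin D) → ℝ) (β₁ β₂ η δ : ℝ) (s : AdamState D) :
    AdamState D :=
  let g : EuclideanSpace ℝ (Fin D) := gradient f s.θ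
  let m' : Fin D → ℝ := fun j => β₁ * s.m j + (1 - β₁) * g j
  let v' : Fin D → ℝ := fun j => β₂ * s.v j + (1 - β₂) * (g j) ^ 2
  { θ := WithLp.toLp 2 (fun j => s.θ j - η * (m' j / (Real.sqrt (v' j) + δ)))
    m := WithLp.toLp 2 m'
    v := WithLp.toLp 2 v' }

/-- Adam on `f` with constant step-size `η`, first iterate `θ₁`, initial momentum `m₀` and `v₀ = 0`.
`adam … T` is the state `(θ_{T+1}, m_T, v_T)` after `T` iterations. -/
def adam {D : ℕ} (f : EuclideanSpace ℝ (Fin D) → ℝ) (β₁ β₂ η δ : ℝ)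
    (θ₁ m₀ : EuclideanSpace ℝ (Fin D)) : ℕ → AdamState D
  | 0 => { θ := θ₁, m := m₀, v := 0 }
  | T + 1 => adamStep f β₁ β₂ η δ (adam f β₁ β₂ η δ θ₁ m₀ T)

end

/-! With signed features `a i = y i • x i` of `ℓ₁` norm at most `R`, let `G` be the mean of the
weights `1 / (1 + exp z)`. The gradient satisfies `γ G ≤ ‖∇f‖₁ ≤ R G`, and the second-order error of
a step with coordinates at most `τ` is at most `(R τ)² G`. Both scale with `G`, so a step-size
proportional to `γ` works at every accuracy.

The obstacle is that `g * m / √v` may be negative, because momentum lags behind the gradient.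
`adam_amortized` bounds this product below, in each coordinate, by the increment of a potential
built from `m² / √v` and `√v`, plus a multiple of `|g|` (through `le_sqrt_adam`). Hence `f + η P`
drops by a multiple of `η γ G` per iteration (`adamStep_descent`). The potential stays negligible:
`P` is at most a multiple of `∑ √v`, which remains `O(G)` because `√v` decays geometrically while
`G` varies slowly (`adamStep_mass_le`). So `η P ≤ G / 4 ≤ f / 4`.

Since `n G ≥ n f / (1 + n f)`, the quantity `Ψ = n (f + η P)` obeys `Ψ' ≤ Ψ - c Ψ / (1 + Ψ)` with
`c` of order `γ²`. Then `Ψ + log Ψ` falls by `c` per iteration from at most `3 n`, which covers both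
the initial phase and the linear convergence. -/

/-! ### The scalar logistic function -/

/-- The negative derivative `1 / (1 + exp z)` of the logistic function `ln (1 + exp (-z))`. -/
noncomputable def logisticWeight (z : ℝ) : ℝ := 1 / (1 + Real.exp z)

lemma logisticWeight_pos (z : ℝ) : 0 < logisticWeight z := by
  unfold logisticWeight; positivity

lemma logisticWeight_le_one (z : ℝ) : logisticWeight z ≤ 1 := by
  unfold logisticWeight
  rw [div_le_one (by positivity)]
  linarith [Real.exp_pos z]

lemma logistic_pos (z : ℝ) : 0 < Real.log (1 + Real.exp (-z)) :=
  Real.log_pos (by linarith [Real.exp_pos (-z)])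

lemma logisticWeight_eq (z : ℝ) :
    logisticWeight z = Real.exp (-z) / (1 + Real.exp (-z)) := by
  unfold logisticWeight
  rw [Real.exp_neg]
  have := Real.exp_pos z
  field_simp
  ring

lemma logisticWeight_le_logistic (z : ℝ) :
    logisticWeight z ≤ Real.log (1 + Real.exp (-z)) := by
  have h0 := Real.exp_pos (-z)
  have h := Real.one_sub_inv_le_log_of_pos (x := 1 + Real.exp (-z)) (by positivity)
  refine le_trans (le_of_eq ?_) h
  rw [logisticWeight_eq]
  field_simp
  ring

/-- The weight is `e / (1 + e)` with `e = exp (-z)`; the map `t / (1 + t)` is increasing and the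
loss is at most `e`. -/
lemma logistic_div_le_logisticWeight (z : ℝ) :
    Real.log (1 + Real.exp (-z)) / (1 + Real.log (1 + Real.exp (-z))) ≤ logisticWeight z := by
  have h0 := Real.exp_pos (-z)
  have hl := logistic_pos z
  set l := Real.log (1 + Real.exp (-z)) with hl_def
  have hle : 1 + l ≤ 1 + Real.exp (-z) := by
    have := Real.log_le_sub_one_of_pos (x := 1 + Real.exp (-z)) (by positivity)
    linarith
  rw [logisticWeight_eq, div_le_div_iff₀ (by positivity) (by positivity)]
  nlinarith

/-- The curvature term carries the factor `logisticWeight z`, so it vanishes along with the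
first-order term as the loss tends to zero. -/
lemma logistic_add_le (z d : ℝ) (hd : |d| ≤ 1) :
    Real.log (1 + Real.exp (-(z + d))) ≤
      Real.log (1 + Real.exp (-z)) - logisticWeight z * d + logisticWeight z * d ^ 2 := by
  have hz := Real.exp_pos (-z)
  have hw := logisticWeight_pos z
  have hexp : Real.exp (-d) - 1 ≤ -d + d ^ 2 := by
    have := Real.abs_exp_sub_one_sub_id_le (x := -d) (by rwa [abs_neg])
    have := (abs_le.mp this).2
    nlinarith
  have hratio : (1 + Real.exp (-(z + d))) / (1 + Real.exp (-z)) =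
      1 + logisticWeight z * (Real.exp (-d) - 1) := by
    rw [logisticWeight_eq, neg_add, Real.exp_add]
    field_simp
    ring
  have hlog := Real.log_le_sub_one_of_pos
    (x := (1 + Real.exp (-(z + d))) / (1 + Real.exp (-z))) (by positivity)
  rw [Real.log_div (by positivity) (by positivity), hratio] at hlog
  nlinarith [mul_le_mul_of_nonneg_left hexp hw.le]

lemma logisticWeight_le_exp_mul (z d τ : ℝ) (hd : |d| ≤ τ) :
    logisticWeight z ≤ Real.exp τ * logisticWeight (z + d) := by
  unfold logisticWeight
  have hz := Real.exp_pos z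
  have h1 : Real.exp (z + d) ≤ Real.exp τ * Real.exp z := by
    rw [← Real.exp_add]
    exact Real.exp_le_exp.mpr (by linarith [(abs_le.mp hd).2])
  have h2 : 1 ≤ Real.exp τ := Real.one_le_exp ((abs_nonneg d).trans hd)
  rw [mul_one_div, div_le_div_iff₀ (by positivity) (by positivity)]
  linarith

lemma hasDerivAt_logistic (z : ℝ) :
    HasDerivAt (fun z => Real.log (1 + Real.exp (-z))) (-logisticWeight z) z := by
  have h := (((hasDerivAt_neg z).exp).const_add 1).log
    (by have := Real.exp_pos (-z); positivity)
  convert h using 1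
  rw [logisticWeight_eq]
  ring

lemma sum_div_one_add_sum_le {ι : Type*} (s : Finset ι) (l : ι → ℝ) (hl : ∀ i ∈ s, 0 ≤ l i) :
    (∑ i ∈ s, l i) / (1 + ∑ i ∈ s, l i) ≤ ∑ i ∈ s, l i / (1 + l i) := by
  rw [Finset.sum_div]
  refine Finset.sum_le_sum fun i hi => ?_
  have h1 := Finset.single_le_sum hl hi
  have h0 := hl i hi
  exact div_le_div_of_nonneg_left h0 (by positivity) (by linarith)

/-! ### The Adam recursion in a single coordinate -/

/-- Convexity of the square, then `β₁ ≤ β₂`. This invariant bounds every coordinate of the update.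
-/
lemma adam_moment_sq_le {β₁ β₂ m v g : ℝ} (h1 : 0 ≤ β₁) (h12 : β₁ ≤ β₂) (h2 : β₂ < 1)
    (hm : (1 - β₂) * m ^ 2 ≤ v) :
    (1 - β₂) * (β₁ * m + (1 - β₁) * g) ^ 2 ≤ β₂ * v + (1 - β₂) * g ^ 2 := by
  have hconv : (β₁ * m + (1 - β₁) * g) ^ 2 ≤ β₁ * m ^ 2 + (1 - β₁) * g ^ 2 := by
    nlinarith [mul_nonneg (mul_nonneg h1 (by linarith : 0 ≤ 1 - β₁)) (sq_nonneg (m - g))]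
  have hv : 0 ≤ v := le_trans (mul_nonneg (by linarith) (sq_nonneg m)) hm
  have ha := mul_le_mul_of_nonneg_left hconv (by linarith : 0 ≤ 1 - β₂)
  have hb := mul_le_mul_of_nonneg_left hm h1
  have hc := mul_le_mul_of_nonneg_right h12 hv
  have hd := mul_nonneg (mul_nonneg h1 (by linarith : 0 ≤ 1 - β₂)) (sq_nonneg g)
  linarith

lemma abs_div_sqrt_le {b m v : ℝ} (hb0 : 0 ≤ b) (hb : b < 1) (hm : (1 - b) * m ^ 2 ≤ v) :
    |m / √v| ≤ 1 / (1 - b) := by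
  have hb' : 0 < 1 - b := by linarith
  have hv : 0 ≤ v := le_trans (mul_nonneg hb'.le (sq_nonneg m)) hm
  rcases hv.eq_or_lt with h | h
  · rw [← h]; simp; linarith
  · have hs := Real.sqrt_pos.mpr h
    rw [abs_div, abs_of_pos hs, div_le_div_iff₀ hs hb', one_mul]
    refine Real.le_sqrt_of_sq_le ?_
    rw [mul_pow, sq_abs]
    nlinarith [mul_nonneg hb'.le (sq_nonneg m)]

lemma sq_div_sqrt_le {b m v : ℝ} (hb : b < 1) (hm : (1 - b) * m ^ 2 ≤ v) :
    m ^ 2 / √v ≤ 1 / (1 - b) * √v := by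
  have hb' : 0 < 1 - b := by linarith
  have hv : 0 ≤ v := le_trans (mul_nonneg hb'.le (sq_nonneg m)) hm
  refine div_le_of_le_mul₀ (Real.sqrt_nonneg v) (by positivity) ?_
  rw [mul_assoc, Real.mul_self_sqrt hv, one_div_mul_eq_div, le_div_iff₀ hb']
  linarith

lemma sqrt_adam_le {r v g : ℝ} (hr0 : 0 ≤ r) (hv : 0 ≤ v) :
    √(r ^ 2 * v + (1 - r ^ 2) * g ^ 2) ≤ r * √v + |g| := by
  refine Real.sqrt_le_iff.mpr ⟨by positivity, ?_⟩
  have := Real.sq_sqrt hv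
  nlinarith [mul_nonneg (mul_nonneg hr0 (Real.sqrt_nonneg v)) (abs_nonneg g), sq_abs g,
    mul_nonneg (sq_nonneg r) (sq_nonneg g)]

lemma le_sqrt_adam {b v g : ℝ} (hb0 : 0 ≤ b) (hb : b < 1) (hv : 0 ≤ v) :
    (1 - b) * |g| ≤ √(b * v + (1 - b) * g ^ 2) := by
  refine Real.le_sqrt_of_sq_le ?_
  rw [mul_pow, sq_abs]
  nlinarith [mul_nonneg hb0 hv, mul_nonneg (mul_nonneg hb0 (by linarith : 0 ≤ 1 - b)) (sq_nonneg g)]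

/-- Amortized lower bound for the decrease of the objective in one coordinate. -/
lemma adam_amortized {r β₁ m v g m' v' : ℝ} (hr0 : 0 < r) (hr : r < 1) (h1 : 0 ≤ β₁)
    (h12 : β₁ ≤ r ^ 2) (hm : (1 - r ^ 2) * m ^ 2 ≤ v) (hm' : m' = β₁ * m + (1 - β₁) * g)
    (hv' : v' = r ^ 2 * v + (1 - r ^ 2) * g ^ 2) :
    1 / 2 * (m' ^ 2 / √v' - m ^ 2 / √v) +
      (1 - r) / 2 * ((1 - β₁) ^ 2 / (2 * (1 - r ^ 2))) * (√v' - r * √v) ≤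
      (1 - β₁) * (g * (m' / √v')) := by
  have hb : 0 < 1 - r ^ 2 := by nlinarith
  have hv : 0 ≤ v := le_trans (mul_nonneg hb.le (sq_nonneg m)) hm
  have hv'0 : 0 ≤ v' := by rw [hv']; positivity
  have hle : r * √v ≤ √v' := by
    refine Real.le_sqrt_of_sq_le ?_
    rw [mul_pow, Real.sq_sqrt hv, hv']
    nlinarith [mul_nonneg hb.le (sq_nonneg g)]
  rcases hv'0.eq_or_lt with h | h
  · have hg : √v' = 0 := by rw [← h]; simp
    have hs : √v = 0 := by
      rw [hg] at hle
      nlinarith [Real.sqrt_nonneg v]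
    simp [hg, hs]
  have hs' := Real.sqrt_pos.mpr h
  have hsv := Real.sqrt_nonneg v
  have hsq := Real.sq_sqrt hv
  have hsq' := Real.sq_sqrt hv'0
  -- Replacing the new denominator by the old one costs a factor `1 / r`. If `v = 0` then `m = 0`,
  -- and both sides vanish.
  have hw : r * (m ^ 2 / √v') ≤ m ^ 2 / √v := by
    rcases hsv.eq_or_lt with h0 | h0
    · have : m ^ 2 = 0 := by
        have : v = 0 := by rw [← hsq, ← h0]; simp
        nlinarith [sq_nonneg m]
      simp [this]
    · rw [← mul_div_assoc, div_le_div_iff₀ hs' h0]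
      nlinarith [mul_le_mul_of_nonneg_left hle (sq_nonneg m)]
  set s := √v
  set s' := √v'
  set w := m ^ 2 / s
  have hw0 : 0 ≤ w := div_nonneg (sq_nonneg _) hsv
  have hu0 : 0 ≤ m ^ 2 / s' := by positivity
  have hw'0 : 0 ≤ m' ^ 2 / s' := by positivity
  -- Substitute `(1 - β₁) g = m' - β₁ m` and apply AM-GM to the cross term. The left side equals
  -- half the increment of `m² / √v` plus `(1 - r) / 2` times the sum of its new and old values.
  have hq : m' ^ 2 / s' - r / 2 * (m' ^ 2 / s') - r / 2 * w ≤ (1 - β₁) * (g * (m' / s')) := by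
    have e : (1 - β₁) * (g * (m' / s')) = m' ^ 2 / s' - β₁ * (m * m' / s') := by
      rw [hm']; field_simp; ring
    have e2 : m * m' / s' ≤ (m ^ 2 / s' + m' ^ 2 / s') / 2 := by
      rw [← add_div, div_right_comm]
      exact div_le_div_of_nonneg_right (by linarith [sq_nonneg (m - m')]) hs'.le
    have e3 := mul_le_mul_of_nonneg_left e2 h1
    have e4 := mul_le_mul_of_nonneg_right h12 hu0
    have e5 := mul_le_mul_of_nonneg_right (h12.trans (by nlinarith : r ^ 2 ≤ r)) hw'0
    have e6 := mul_le_mul_of_nonneg_left hw hr0.le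
    rw [e]
    linarith
  -- That sum pays for the growth of `√v`, which comes only from `g²`, and `g` is controlled by `m'`
  -- and `m`.
  have hκ : (1 - β₁) ^ 2 / (2 * (1 - r ^ 2)) * (s' - r * s) ≤ m' ^ 2 / s' + w := by
    have e1 : (s' - r * s) * s' ≤ (1 - r ^ 2) * g ^ 2 := by
      have e0 : (1 - r ^ 2) * g ^ 2 = s' ^ 2 - r ^ 2 * s ^ 2 := by
        rw [hsq, hsq', hv']; ring
      rw [e0]
      nlinarith [mul_nonneg (mul_nonneg hr0.le hsv) (sub_nonneg.mpr hle)]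
    have e2 : (1 - β₁) ^ 2 * g ^ 2 ≤ 2 * (m' ^ 2 + β₁ ^ 2 * m ^ 2) := by
      have : (1 - β₁) ^ 2 * g ^ 2 = (m' - β₁ * m) ^ 2 := by rw [hm']; ring
      rw [this]
      linarith [sq_nonneg (m' + β₁ * m)]
    have e3 : β₁ ^ 2 ≤ r := by
      have : β₁ ≤ 1 := h12.trans (by nlinarith)
      nlinarith
    have e4 : (1 - β₁) ^ 2 / (2 * (1 - r ^ 2)) * (s' - r * s) ≤
        m' ^ 2 / s' + β₁ ^ 2 * (m ^ 2 / s') := by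
      rw [← mul_div_assoc, ← add_div, le_div_iff₀ hs', div_mul_eq_mul_div, div_mul_eq_mul_div,
        div_le_iff₀ (by positivity)]
      linarith [mul_le_mul_of_nonneg_left e1 (sq_nonneg (1 - β₁)),
        mul_le_mul_of_nonneg_left e2 hb.le]
    have e5 := mul_le_mul_of_nonneg_right e3 hu0
    linarith
  have := mul_le_mul_of_nonneg_left hκ (by linarith : 0 ≤ (1 - r) / 2)
  linarith

/-! ### Logistic regression on signed features `a i = y i • x i` -/

/-- The unnormalized margin of the `i`-th signed data point. -/
noncomputable def score {n D : ℕ} (a : Fin n → Fin D → ℝ) (θ : EuclideanSpace ℝ (Fin D))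
    (i : Fin n) : ℝ := ∑ j, a i j * θ j

/-- The mean of the logistic weights, comparable to the `ℓ₁` norm of the gradient. -/
noncomputable def meanWeight {n D : ℕ} (a : Fin n → Fin D → ℝ)
    (θ : EuclideanSpace ℝ (Fin D)) : ℝ := 1 / (n : ℝ) * ∑ i, logisticWeight (score a θ i)

/-- The logistic objective in terms of signed features. -/
noncomputable def meanLoss {n D : ℕ} (a : Fin n → Fin D → ℝ)
    (θ : EuclideanSpace ℝ (Fin D)) : ℝ :=
  1 / (n : ℝ) * ∑ i, Real.log (1 + Real.exp (-score a θ i))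

section Loss

variable {n D : ℕ} {a : Fin n → Fin D → ℝ} {θ θ' u : EuclideanSpace ℝ (Fin D)}

lemma logisticLoss_eq_meanLoss (x : Fin n → EuclideanSpace ℝ (Fin D)) (y : Fin n → ℝ) :
    logisticLoss x y = meanLoss fun i j => y i * x i j := by
  funext θ
  unfold logisticLoss meanLoss score
  congr 1
  refine Finset.sum_congr rfl fun i _ => ?_
  congr 4
  rw [PiLp.inner_apply, Finset.mul_sum]
  refine Finset.sum_congr rfl fun j _ => ?_
  simp only [RCLike.inner_apply, conj_trivial]
  ring

lemma meanWeight_nonneg : 0 ≤ meanWeight a θ :=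
  mul_nonneg (by positivity) (Finset.sum_nonneg fun _ _ => (logisticWeight_pos _).le)

lemma meanWeight_le_one (hn : 0 < n) : meanWeight a θ ≤ 1 := by
  have hn' : (0 : ℝ) < n := by exact_mod_cast hn
  unfold meanWeight
  rw [one_div_mul_eq_div, div_le_one hn']
  calc _ ≤ ∑ _i : Fin n, (1 : ℝ) := Finset.sum_le_sum fun _ _ => logisticWeight_le_one _
    _ = n := by simp

lemma meanWeight_le_meanLoss : meanWeight a θ ≤ meanLoss a θ :=
  mul_le_mul_of_nonneg_left
    (Finset.sum_le_sum fun _ _ => logisticWeight_le_logistic _) (by positivity)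

lemma meanLoss_pos (hn : 0 < n) : 0 < meanLoss a θ := by
  have : Nonempty (Fin n) := ⟨⟨0, hn⟩⟩
  exact mul_pos (by positivity)
    (Finset.sum_pos (fun _ _ => logistic_pos _) Finset.univ_nonempty)

lemma meanLoss_zero (hn : 0 < n) : meanLoss a 0 = Real.log 2 := by
  have hn' : (n : ℝ) ≠ 0 := by positivity
  simp [meanLoss, score, one_add_one_eq_two, hn']

lemma div_one_add_le_meanWeight (hn : 0 < n) :
    n * meanLoss a θ / (1 + n * meanLoss a θ) ≤ n * meanWeight a θ := by
  have hn' : (n : ℝ) ≠ 0 := by positivity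
  unfold meanLoss meanWeight
  simp only [← mul_assoc, mul_one_div_cancel hn', one_mul]
  exact (sum_div_one_add_sum_le _ _ fun _ _ => (logistic_pos _).le).trans
    (Finset.sum_le_sum fun _ _ => logistic_div_le_logisticWeight _)

lemma hasGradientAt_meanLoss :
    HasGradientAt (meanLoss a)
      (WithLp.toLp 2 fun j => -(1 / (n : ℝ) * ∑ i, logisticWeight (score a θ i) * a i j)) θ := by
  have hscore : ∀ i, HasFDerivAt (fun θ : EuclideanSpace ℝ (Fin D) => score a θ i)
      (innerSL ℝ (WithLp.toLp 2 (a i) : EuclideanSpace ℝ (Fin D))) θ := by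
    intro i
    have : (fun θ : EuclideanSpace ℝ (Fin D) => score a θ i) =
        innerSL ℝ (WithLp.toLp 2 (a i) : EuclideanSpace ℝ (Fin D)) := by
      funext θ
      simp [score, PiLp.inner_apply, mul_comm]
    rw [this]
    exact ContinuousLinearMap.hasFDerivAt _
  have hsum := (HasFDerivAt.fun_sum (u := Finset.univ) fun i _ =>
    (hasDerivAt_logistic (score a θ i)).comp_hasFDerivAt θ (hscore i)).const_mul (1 / (n : ℝ))
  rw [hasGradientAt_iff_hasFDerivAt]
  refine hsum.congr_fderiv ?_
  ext w
  simp only [smul_apply, sum_apply, innerSL_apply_apply,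
    InnerProductSpace.toDual_apply_apply, PiLp.inner_apply, smul_eq_mul, RCLike.inner_apply,
    conj_trivial, Finset.mul_sum, mul_neg, neg_mul, Finset.sum_neg_distrib]
  rw [Finset.sum_comm]
  refine congrArg Neg.neg (Finset.sum_congr rfl fun j _ => Finset.sum_congr rfl fun i _ => ?_)
  ring

lemma gradient_meanLoss_apply (j : Fin D) :
    gradient (meanLoss a) θ j =
      -(1 / (n : ℝ) * ∑ i, logisticWeight (score a θ i) * a i j) := by
  rw [hasGradientAt_meanLoss.gradient]

lemma sum_gradient_mul (u : Fin D → ℝ) :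
    ∑ j, gradient (meanLoss a) θ j * u j =
      -(1 / (n : ℝ) * ∑ i, logisticWeight (score a θ i) * ∑ j, a i j * u j) := by
  simp only [gradient_meanLoss_apply, Finset.mul_sum, Finset.sum_mul, neg_mul,
    Finset.sum_neg_distrib]
  rw [Finset.sum_comm]
  refine congrArg Neg.neg (Finset.sum_congr rfl fun j _ => Finset.sum_congr rfl fun i _ => ?_)
  ring

lemma abs_sum_mul_le {R τ : ℝ} {a u : Fin D → ℝ} (ha : ∑ j, |a j| ≤ R) (hτ : 0 ≤ τ)
    (hu : ∀ j, |u j| ≤ τ) : |∑ j, a j * u j| ≤ R * τ := by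
  calc |∑ j, a j * u j| ≤ ∑ j, |a j * u j| := Finset.abs_sum_le_sum_abs _ _
    _ ≤ ∑ j, |a j| * τ := Finset.sum_le_sum fun j _ => by
        rw [abs_mul]; exact mul_le_mul_of_nonneg_left (hu j) (abs_nonneg _)
    _ = (∑ j, |a j|) * τ := by rw [Finset.sum_mul]
    _ ≤ R * τ := mul_le_mul_of_nonneg_right ha hτ

lemma sum_abs_gradient_le {R : ℝ} (ha : ∀ i, ∑ j, |a i j| ≤ R) :
    ∑ j, |gradient (meanLoss a) θ j| ≤ R * meanWeight a θ := by
  have h : ∀ j, |gradient (meanLoss a) θ j| ≤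
      1 / (n : ℝ) * ∑ i, logisticWeight (score a θ i) * |a i j| := by
    intro j
    rw [gradient_meanLoss_apply, abs_neg, abs_mul, abs_of_nonneg (by positivity : 0 ≤ 1 / (n : ℝ))]
    refine mul_le_mul_of_nonneg_left ((Finset.abs_sum_le_sum_abs _ _).trans (le_of_eq ?_))
      (by positivity)
    refine Finset.sum_congr rfl fun i _ => ?_
    rw [abs_mul, abs_of_pos (logisticWeight_pos _)]
  refine (Finset.sum_le_sum fun j _ => h j).trans ?_
  rw [← Finset.mul_sum, Finset.sum_comm, meanWeight, mul_left_comm]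
  refine mul_le_mul_of_nonneg_left ?_ (by positivity)
  rw [Finset.mul_sum]
  refine Finset.sum_le_sum fun i _ => ?_
  rw [← Finset.mul_sum, mul_comm R]
  exact mul_le_mul_of_nonneg_left (ha i) (logisticWeight_pos _).le

/-- `ℓ₁`–`ℓ∞` duality: test the gradient against the separating direction `d`. -/
lemma mul_meanWeight_le_sum_abs_gradient {γ : ℝ} {d : Fin D → ℝ} (hd : ∀ j, |d j| ≤ 1)
    (hγ : ∀ i, γ ≤ ∑ j, a i j * d j) :
    γ * meanWeight a θ ≤ ∑ j, |gradient (meanLoss a) θ j| := by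
  have h1 : γ * meanWeight a θ ≤ -∑ j, gradient (meanLoss a) θ j * d j := by
    rw [sum_gradient_mul, neg_neg, meanWeight, mul_left_comm, Finset.mul_sum]
    refine mul_le_mul_of_nonneg_left (Finset.sum_le_sum fun i _ => ?_) (by positivity)
    rw [mul_comm]
    exact mul_le_mul_of_nonneg_left (hγ i) (logisticWeight_pos _).le
  refine h1.trans ((neg_le_abs _).trans ((Finset.abs_sum_le_sum_abs _ _).trans
    (Finset.sum_le_sum fun j _ => ?_)))
  rw [abs_mul]
  exact mul_le_of_le_one_right (abs_nonneg _) (hd j)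

lemma score_add (i : Fin n) : score a (θ + u) i = score a θ i + ∑ j, a i j * u j := by
  simp [score, mul_add, Finset.sum_add_distrib]

lemma meanWeight_le_exp_mul {R τ : ℝ} (ha : ∀ i, ∑ j, |a i j| ≤ R) (hτ : 0 ≤ τ)
    (hu : ∀ j, |u j| ≤ τ) :
    meanWeight a θ ≤ Real.exp (R * τ) * meanWeight a (θ + u) := by
  unfold meanWeight
  rw [mul_left_comm, Finset.mul_sum _ _ (Real.exp _)]
  refine mul_le_mul_of_nonneg_left (Finset.sum_le_sum fun i _ => ?_) (by positivity)
  rw [score_add]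
  exact logisticWeight_le_exp_mul _ _ _ (abs_sum_mul_le (ha i) hτ hu)

lemma meanLoss_add_le {R τ : ℝ} (ha : ∀ i, ∑ j, |a i j| ≤ R) (hτ : 0 ≤ τ)
    (hu : ∀ j, |u j| ≤ τ) (hRτ : R * τ ≤ 1) :
    meanLoss a (θ + u) ≤ meanLoss a θ + ∑ j, gradient (meanLoss a) θ j * u j +
      (R * τ) ^ 2 * meanWeight a θ := by
  rw [sum_gradient_mul]
  have key : ∀ i, Real.log (1 + Real.exp (-score a (θ + u) i)) ≤
      Real.log (1 + Real.exp (-score a θ i)) -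
        logisticWeight (score a θ i) * (∑ j, a i j * u j) +
        (R * τ) ^ 2 * logisticWeight (score a θ i) := by
    intro i
    have hd := abs_sum_mul_le (ha i) hτ hu
    rw [score_add]
    refine (logistic_add_le _ _ (hd.trans hRτ)).trans ?_
    rw [mul_comm ((R * τ) ^ 2)]
    have := mul_le_mul_of_nonneg_left (sq_le_sq' (neg_le_of_abs_le hd) (le_of_abs_le hd))
      (logisticWeight_pos (score a θ i)).le
    linarith
  have hs := mul_le_mul_of_nonneg_left (Finset.sum_le_sum fun i (_ : i ∈ Finset.univ) => key i)
    (one_div_nonneg.mpr (Nat.cast_nonneg (α := ℝ) n))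
  simp only [Finset.sum_add_distrib, Finset.sum_sub_distrib, ← Finset.mul_sum] at hs
  unfold meanLoss meanWeight
  linarith

end Loss

/-! ### Separating direction in the sup-norm ball, and the scalar recursion -/

lemma exists_direction_of_normalizedMargin {n D : ℕ} {p : ℝ≥0∞} (hp : 1 ≤ p)
    {x : Fin n → EuclideanSpace ℝ (Fin D)} {y : Fin n → ℝ} {θ : EuclideanSpace ℝ (Fin D)}
    {γ : ℝ} (hγ : 0 < γ) (h : normalizedMargin p x y θ = γ) :
    ∃ d : Fin D → ℝ, (∀ j, |d j| ≤ 1) ∧ ∀ i, γ ≤ ∑ j, y i * x i j * d j := by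
  have : Fact (1 ≤ p) := ⟨hp⟩
  set N := lpNormVec p θ with hN
  have hN0 : 0 ≤ N := norm_nonneg _
  have hNpos : 0 < N := by
    -- At norm zero, division by zero would make the margin `0`.
    refine hN0.lt_of_ne fun h0 => hγ.ne' ?_
    rw [← h, normalizedMargin, ← hN, ← h0]
    simp
  refine ⟨fun j => θ j / N, fun j => ?_, fun i => ?_⟩
  · rw [abs_div, abs_of_pos hNpos, div_le_one hNpos]
    exact PiLp.norm_apply_le (WithLp.toLp p θ.ofLp : PiLp p (fun _ : Fin D => ℝ)) j
  · rw [← h, normalizedMargin]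
    refine (ciInf_le (Set.finite_range _).bddBelow i).trans (le_of_eq ?_)
    rw [PiLp.inner_apply, Finset.mul_sum, Finset.sum_div]
    refine Finset.sum_congr rfl fun j _ => ?_
    simp only [RCLike.inner_apply, conj_trivial, ← hN]
    ring

/-- The drops of `Ψ` and `log Ψ` are at least `c Ψ / (1 + Ψ)` and `c / (1 + Ψ)`, which add up to
`c`. -/
lemma add_log_le_of_decrease {Ψ : ℕ → ℝ} {c : ℝ} (hpos : ∀ k, 0 < Ψ k)
    (hdec : ∀ k, Ψ (k + 1) ≤ Ψ k - c * (Ψ k / (1 + Ψ k))) (k : ℕ) :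
    Ψ k + Real.log (Ψ k) ≤ Ψ 0 + Real.log (Ψ 0) - c * k := by
  induction k with
  | zero => simp
  | succ k ih =>
    have h0 := hpos k
    have h1 := hpos (k + 1)
    have hlog := Real.log_le_sub_one_of_pos (div_pos h1 h0)
    rw [Real.log_div h1.ne' h0.ne'] at hlog
    have hd : Ψ (k + 1) / Ψ k ≤ 1 - c / (1 + Ψ k) := by
      rw [div_le_iff₀ h0]
      refine (hdec k).trans (le_of_eq ?_)
      ring
    have e : c * (Ψ k / (1 + Ψ k)) + c / (1 + Ψ k) = c := by
      field_simp
      ring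
    have := hdec k
    push_cast
    linarith

/-! ### One iteration of Adam on the logistic objective -/

/-- The second-moment mass `∑ⱼ √vⱼ`. -/
noncomputable def AdamState.mass {D : ℕ} (s : AdamState D) : ℝ := ∑ j, √(s.v j)

/-- The amortization weight of `√v` in the potential. -/
noncomputable def adamWeight (β₁ r : ℝ) : ℝ :=
  (1 - r) / 2 * ((1 - β₁) ^ 2 / (2 * (1 - r ^ 2)))

/-- The potential that amortizes the lag of the moment estimates behind the gradient. -/
noncomputable def AdamState.potential {D : ℕ} (β₁ r : ℝ) (s : AdamState D) : ℝ :=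
  ∑ j, (1 / 2 * (s.m j ^ 2 / √(s.v j)) + adamWeight β₁ r * r * √(s.v j)) / (1 - β₁)

/-- The second moment dominates the square of the first. -/
def AdamState.Dominated {D : ℕ} (b : ℝ) (s : AdamState D) : Prop :=
  ∀ j, (1 - b) * s.m j ^ 2 ≤ s.v j

section Step

variable {n D : ℕ} {a : Fin n → Fin D → ℝ} {f : EuclideanSpace ℝ (Fin D) → ℝ}
  {β₁ b r η R : ℝ} {s : AdamState D}

lemma adamWeight_pos (hr0 : 0 < r) (hr : r < 1) (h1 : β₁ < 1) : 0 < adamWeight β₁ r := by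
  have : 0 < 1 - r ^ 2 := by nlinarith
  have : 0 < 1 - β₁ := by linarith
  have : 0 < 1 - r := by linarith
  unfold adamWeight
  positivity

lemma AdamState.potential_nonneg (hr0 : 0 < r) (hr : r < 1) (h1 : β₁ < 1) :
    0 ≤ s.potential β₁ r := by
  have := adamWeight_pos hr0 hr h1
  have : 0 < 1 - β₁ := by linarith
  exact Finset.sum_nonneg fun _ _ => by positivity

lemma AdamState.Dominated.potential_le (hr0 : 0 < r) (hr : r < 1) (h1 : β₁ < 1)
    (hs : s.Dominated (r ^ 2)) :
    s.potential β₁ r ≤ (1 / 2 * (1 / (1 - r ^ 2)) + adamWeight β₁ r * r) / (1 - β₁) * s.mass := by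
  rw [AdamState.potential, AdamState.mass, Finset.mul_sum]
  refine Finset.sum_le_sum fun j _ => ?_
  have hβ : 0 ≤ 1 - β₁ := by linarith
  rw [div_mul_eq_mul_div _ (1 - β₁)]
  refine div_le_div_of_nonneg_right ?_ hβ
  have := sq_div_sqrt_le (by nlinarith : r ^ 2 < 1) (hs j)
  linarith

lemma adamStep_m (j : Fin D) : (adamStep f β₁ b η 0 s).m j =
    β₁ * s.m j + (1 - β₁) * gradient f s.θ j := rfl

lemma adamStep_v (j : Fin D) : (adamStep f β₁ b η 0 s).v j =
    b * s.v j + (1 - b) * gradient f s.θ j ^ 2 := rfl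

lemma adamStep_θ : (adamStep f β₁ b η 0 s).θ = s.θ + WithLp.toLp 2 fun j =>
    -(η * ((adamStep f β₁ b η 0 s).m j / √((adamStep f β₁ b η 0 s).v j))) := by
  ext j
  simp [adamStep, sub_eq_add_neg]

lemma AdamState.Dominated.adamStep (h1 : 0 ≤ β₁) (h12 : β₁ ≤ b) (h2 : b < 1)
    (hs : s.Dominated b) : (adamStep f β₁ b η 0 s).Dominated b :=
  fun j => adam_moment_sq_le h1 h12 h2 (hs j)

lemma AdamState.Dominated.abs_update_le (hb0 : 0 ≤ b) (hb : b < 1) (hη : 0 ≤ η)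
    (hs : s.Dominated b) (j : Fin D) :
    |-(η * (s.m j / √(s.v j)))| ≤ η * (1 / (1 - b)) := by
  rw [abs_neg, abs_mul, abs_of_nonneg hη]
  exact mul_le_mul_of_nonneg_left (abs_div_sqrt_le hb0 hb (hs j)) hη

/-- The mass contracts by `r` up to the new gradient, while `G` shrinks by a factor at most `1 + (1
- r) / 2`; the invariant survives because `(r + (1 - r) / 4) (1 + (1 - r) / 2) ≤ 1`. -/
lemma adamStep_mass_le (ha : ∀ i, ∑ j, |a i j| ≤ R) (hR : 0 ≤ R) (hr0 : 0 < r) (hr : r < 1)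
    (hη : 0 ≤ η) (hητ : R * (η * (1 / (1 - r ^ 2))) ≤ (1 - r) / 8) (hv : ∀ j, 0 ≤ s.v j)
    (hmass : s.mass ≤ 4 * R / (1 - r) * meanWeight a s.θ)
    (hs' : (adamStep (meanLoss a) β₁ (r ^ 2) η 0 s).Dominated (r ^ 2)) :
    (adamStep (meanLoss a) β₁ (r ^ 2) η 0 s).mass ≤
      4 * R / (1 - r) * meanWeight a (adamStep (meanLoss a) β₁ (r ^ 2) η 0 s).θ := by
  have hb : 0 < 1 - r ^ 2 := by nlinarith
  have h1r : 0 < 1 - r := by linarith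
  have hτ : 0 ≤ η * (1 / (1 - r ^ 2)) := by positivity
  have hG := meanWeight_le_exp_mul (θ := s.θ) ha hτ
    (u := WithLp.toLp 2 fun j => -(η * ((adamStep (meanLoss a) β₁ (r ^ 2) η 0 s).m j /
      √((adamStep (meanLoss a) β₁ (r ^ 2) η 0 s).v j))))
    (hs'.abs_update_le (sq_nonneg r) (by nlinarith) hη)
  rw [← adamStep_θ] at hG
  set s' := adamStep (meanLoss a) β₁ (r ^ 2) η 0 s with hs'_def
  have hG' : 0 ≤ meanWeight a s'.θ := meanWeight_nonneg
  have hexp : Real.exp (R * (η * (1 / (1 - r ^ 2)))) ≤ 1 + (1 - r) / 2 := by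
    have h0 : 0 ≤ R * (η * (1 / (1 - r ^ 2))) := by positivity
    have := (abs_le.mp (Real.abs_exp_sub_one_sub_id_le
      (x := R * (η * (1 / (1 - r ^ 2)))) (by rw [abs_of_nonneg h0]; linarith))).2
    nlinarith
  have hG2 : meanWeight a s.θ ≤ (1 + (1 - r) / 2) * meanWeight a s'.θ :=
    hG.trans (mul_le_mul_of_nonneg_right hexp hG')
  have hV : s'.mass ≤ r * s.mass + R * meanWeight a s.θ := by
    refine le_trans ?_ (add_le_add_right (sum_abs_gradient_le ha) _)
    rw [AdamState.mass, AdamState.mass, Finset.mul_sum, ← Finset.sum_add_distrib]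
    exact Finset.sum_le_sum fun j _ => sqrt_adam_le hr0.le (hv j)
  have hAR : R = 4 * R / (1 - r) * ((1 - r) / 4) := by field_simp
  have hA : 0 ≤ 4 * R / (1 - r) := by positivity
  set A := 4 * R / (1 - r)
  calc s'.mass ≤ r * s.mass + R * meanWeight a s.θ := hV
    _ ≤ r * (A * meanWeight a s.θ) + A * ((1 - r) / 4) * meanWeight a s.θ := by
        rw [← hAR]
        exact add_le_add_left (mul_le_mul_of_nonneg_left hmass hr0.le) _
    _ = A * ((r + (1 - r) / 4) * meanWeight a s.θ) := by ring
    _ ≤ A * ((r + (1 - r) / 4) * ((1 + (1 - r) / 2) * meanWeight a s'.θ)) :=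
        mul_le_mul_of_nonneg_left (mul_le_mul_of_nonneg_left hG2 (by linarith)) hA
    _ = A * (((r + (1 - r) / 4) * (1 + (1 - r) / 2)) * meanWeight a s'.θ) := by ring
    _ ≤ A * (1 * meanWeight a s'.θ) :=
        mul_le_mul_of_nonneg_left (mul_le_mul_of_nonneg_right (by nlinarith) hG') hA
    _ = A * meanWeight a s'.θ := by ring

lemma sum_gradient_mul_update_ge (hr0 : 0 < r) (hr : r < 1) (h1 : 0 ≤ β₁) (h12 : β₁ ≤ r ^ 2)
    (hs : s.Dominated (r ^ 2)) :
    (adamStep f β₁ (r ^ 2) η 0 s).potential β₁ r - s.potential β₁ r +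
      adamWeight β₁ r * (1 - r) * (1 - r ^ 2) / (1 - β₁) * ∑ j, |gradient f s.θ j| ≤
    ∑ j, gradient f s.θ j * ((adamStep f β₁ (r ^ 2) η 0 s).m j /
      √((adamStep f β₁ (r ^ 2) η 0 s).v j)) := by
  have hb : 0 < 1 - r ^ 2 := by nlinarith
  have hβ : 0 < 1 - β₁ := by linarith
  rw [AdamState.potential, AdamState.potential, ← Finset.sum_sub_distrib, Finset.mul_sum,
    ← Finset.sum_add_distrib]
  refine Finset.sum_le_sum fun j _ => ?_
  have hv : 0 ≤ s.v j := le_trans (mul_nonneg hb.le (sq_nonneg _)) (hs j)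
  have h := adam_amortized hr0 hr h1 h12 (hs j) (adamStep_m (f := f) (b := r ^ 2) (η := η) j)
    (adamStep_v (f := f) (β₁ := β₁) (η := η) j)
  have hg := le_sqrt_adam (g := gradient f s.θ j) (sq_nonneg r) (by linarith) hv
  rw [← adamStep_v (f := f) (β₁ := β₁) (η := η) j] at hg
  set s' := adamStep f β₁ (r ^ 2) η 0 s
  have hw := adamWeight_pos hr0 hr (by linarith : β₁ < 1)
  rw [← adamWeight] at h
  -- Split `√v' - r √v` into `r (√v' - √v)`, which telescopes, and `(1 - r) √v'`, which dominates
  -- `|g|`.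
  have hg' := mul_le_mul_of_nonneg_left hg (mul_nonneg hw.le (by linarith : 0 ≤ 1 - r))
  rw [div_mul_eq_mul_div (adamWeight β₁ r * (1 - r) * (1 - r ^ 2)), ← sub_div, ← add_div, div_le_iff₀ hβ]
  linarith

lemma adamStep_descent (ha : ∀ i, ∑ j, |a i j| ≤ R) (hr0 : 0 < r) (hr : r < 1) (h1 : 0 ≤ β₁)
    (h12 : β₁ ≤ r ^ 2) (hη : 0 ≤ η) (hητ : R * (η * (1 / (1 - r ^ 2))) ≤ 1)
    (hs : s.Dominated (r ^ 2)) :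
    meanLoss a (adamStep (meanLoss a) β₁ (r ^ 2) η 0 s).θ +
        η * (adamStep (meanLoss a) β₁ (r ^ 2) η 0 s).potential β₁ r ≤
      meanLoss a s.θ + η * s.potential β₁ r -
        η * (adamWeight β₁ r * (1 - r) * (1 - r ^ 2) / (1 - β₁) *
          ∑ j, |gradient (meanLoss a) s.θ j|) +
        (R * (η * (1 / (1 - r ^ 2)))) ^ 2 * meanWeight a s.θ := by
  have hb : 0 < 1 - r ^ 2 := by nlinarith
  have hs' := hs.adamStep (f := meanLoss a) (η := η) h1 h12 (by linarith)
  have hdesc := meanLoss_add_le (θ := s.θ) ha (by positivity : 0 ≤ η * (1 / (1 - r ^ 2)))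
    (hs'.abs_update_le (sq_nonneg r) (by linarith) hη) hητ
    (u := WithLp.toLp 2 fun j => -(η * ((adamStep (meanLoss a) β₁ (r ^ 2) η 0 s).m j /
      √((adamStep (meanLoss a) β₁ (r ^ 2) η 0 s).v j))))
  rw [← adamStep_θ] at hdesc
  have hq := mul_le_mul_of_nonneg_left
    (sum_gradient_mul_update_ge (f := meanLoss a) (η := η) hr0 hr h1 h12 hs) hη
  set s' := adamStep (meanLoss a) β₁ (r ^ 2) η 0 s
  have e : ∑ j, gradient (meanLoss a) s.θ j * -(η * (s'.m j / √(s'.v j))) =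
      -(η * ∑ j, gradient (meanLoss a) s.θ j * (s'.m j / √(s'.v j))) := by
    rw [Finset.mul_sum, ← Finset.sum_neg_distrib]
    exact Finset.sum_congr rfl fun j _ => by ring
  simp only [e] at hdesc
  linarith

/-- Domination can fail initially, when `v₀ = 0` and `m₀ = ∇f`, but it holds after one step; hence
the potential argument starts there. -/
lemma adamStep_init_dominated (h1 : 0 ≤ β₁) (h1' : β₁ < 1) {m₀ : EuclideanSpace ℝ (Fin D)}
    {θ : EuclideanSpace ℝ (Fin D)} (hb : b < 1) (hm₀ : m₀ = gradient f θ ∨ m₀ = 0) :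
    (adamStep f β₁ b η 0 ⟨θ, m₀, 0⟩).Dominated b := by
  intro j
  rw [adamStep_m, adamStep_v]
  have hb' : 0 ≤ 1 - b := by linarith
  rcases hm₀ with rfl | rfl
  · refine le_of_eq ?_
    simp only [PiLp.zero_apply]
    ring
  · simp only [PiLp.zero_apply, mul_zero, zero_add]
    refine mul_le_mul_of_nonneg_left ?_ hb'
    rw [mul_pow]
    exact mul_le_of_le_one_left (sq_nonneg _) (by nlinarith)

lemma adamStep_meanLoss_le (hn : 0 < n) (ha : ∀ i, ∑ j, |a i j| ≤ R) (hR : 0 ≤ R) (hb0 : 0 ≤ b)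
    (hb : b < 1) (hη : 0 ≤ η) (hητ : R * (η * (1 / (1 - b))) ≤ 1 / 8)
    (hs' : (adamStep (meanLoss a) β₁ b η 0 s).Dominated b) :
    meanLoss a (adamStep (meanLoss a) β₁ b η 0 s).θ ≤ meanLoss a s.θ + 1 / 4 := by
  have hb' : 0 < 1 - b := by linarith
  have hτ : 0 ≤ η * (1 / (1 - b)) := by positivity
  have hu := hs'.abs_update_le hb0 hb hη
  have hdesc := meanLoss_add_le (θ := s.θ) ha hτ (by exact hu) (by linarith)
    (u := WithLp.toLp 2 fun j => -(η * ((adamStep (meanLoss a) β₁ b η 0 s).m j /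
      √((adamStep (meanLoss a) β₁ b η 0 s).v j))))
  rw [← adamStep_θ] at hdesc
  set s' := adamStep (meanLoss a) β₁ b η 0 s
  have h1 := le_of_abs_le (abs_sum_mul_le (sum_abs_gradient_le (θ := s.θ) ha)
    hτ hu)
  have hG0 : 0 ≤ meanWeight a s.θ := meanWeight_nonneg
  have hG1 : meanWeight a s.θ ≤ 1 := meanWeight_le_one hn
  simp only at hdesc
  have h0 : 0 ≤ R * (η * (1 / (1 - b))) := by positivity
  set τ := η * (1 / (1 - b))
  have h2 : R * meanWeight a s.θ * τ ≤ 1 / 8 := by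
    rw [mul_right_comm]
    exact (mul_le_of_le_one_right h0 hG1).trans hητ
  have h3 : (R * τ) ^ 2 * meanWeight a s.θ ≤ 1 / 8 := by
    nlinarith
  linarith

end Step

/-! ### Decrease of the potential along the whole trajectory -/

section Trajectory

variable {n D : ℕ} {a : Fin n → Fin D → ℝ} {β₁ r η R γ : ℝ}

/-- The ratio bounding the potential by the second-moment mass. -/
noncomputable def massCoeff (β₁ r : ℝ) : ℝ :=
  (1 / 2 * (1 / (1 - r ^ 2)) + adamWeight β₁ r * r) / (1 - β₁)

/-- The guaranteed amortized decrease per unit of gradient `ℓ₁` norm. -/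
noncomputable def descentCoeff (β₁ r : ℝ) : ℝ :=
  adamWeight β₁ r * (1 - r) * (1 - r ^ 2) / (1 - β₁)

lemma massCoeff_pos (hr0 : 0 < r) (hr : r < 1) (h1 : β₁ < 1) : 0 < massCoeff β₁ r := by
  have := adamWeight_pos hr0 hr h1
  have : 0 < 1 - r ^ 2 := by nlinarith
  have : 0 < 1 - β₁ := by linarith
  unfold massCoeff
  positivity

lemma descentCoeff_pos (hr0 : 0 < r) (hr : r < 1) (h1 : β₁ < 1) : 0 < descentCoeff β₁ r := by
  have := adamWeight_pos hr0 hr h1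
  have : 0 < 1 - r ^ 2 := by nlinarith
  have : 0 < 1 - β₁ := by linarith
  have : 0 < 1 - r := by linarith
  unfold descentCoeff
  positivity

/-- Along Adam, after one iteration, the loss stays below a potential that decreases linearly
once it is small. -/
lemma adam_add_log_le (hn : 0 < n) (ha : ∀ i, ∑ j, |a i j| ≤ R) (hR : 0 ≤ R)
    (hr0 : 0 < r) (hr : r < 1) (h1 : 0 ≤ β₁) (h12 : β₁ ≤ r ^ 2) (hη : 0 < η) (hγ0 : 0 < γ)
    {d : Fin D → ℝ} (hd : ∀ j, |d j| ≤ 1) (hγ : ∀ i, γ ≤ ∑ j, a i j * d j)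
    (hητ : R * (η * (1 / (1 - r ^ 2))) ≤ (1 - r) / 8)
    (hηA : η * massCoeff β₁ r * (4 * R / (1 - r)) ≤ 1 / 4)
    (hηsq : (R * (η * (1 / (1 - r ^ 2)))) ^ 2 ≤ η * descentCoeff β₁ r * γ / 2)
    {m₀ : EuclideanSpace ℝ (Fin D)} (hm₀ : m₀ = gradient (meanLoss a) 0 ∨ m₀ = 0) (k : ℕ) :
    ∃ Ψ : ℝ, 0 < Ψ ∧ n * meanLoss a (adam (meanLoss a) β₁ (r ^ 2) η 0 0 m₀ (k + 1)).θ ≤ Ψ ∧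
      Ψ + Real.log Ψ ≤ 3 * n - η * descentCoeff β₁ r * γ / 4 * k ∧ Ψ ≤ 3 / 2 * n := by
  have hr2 : r ^ 2 < 1 := by nlinarith
  have hβ : β₁ < 1 := by linarith
  have hn' : (0 : ℝ) < n := by exact_mod_cast hn
  have hc3 := massCoeff_pos hr0 hr hβ
  have hc2 := descentCoeff_pos hr0 hr hβ
  have h1r : 0 < 1 - r := by linarith
  have hA : 0 ≤ 4 * R / (1 - r) := by positivity
  set S : ℕ → AdamState D := adam (meanLoss a) β₁ (r ^ 2) η 0 0 m₀ with hS
  have hSsucc : ∀ k, S (k + 1) = adamStep (meanLoss a) β₁ (r ^ 2) η 0 (S k) := fun _ => rfl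
  have hdom : ∀ k, (S (k + 1)).Dominated (r ^ 2) := by
    intro k
    induction k with
    | zero => exact adamStep_init_dominated h1 hβ hr2 hm₀
    | succ k ih => rw [hSsucc]; exact ih.adamStep h1 h12 hr2
  have hv : ∀ k j, 0 ≤ (S k).v j := by
    intro k j
    cases k with
    | zero => exact le_rfl
    | succ k => exact le_trans (mul_nonneg (by linarith) (sq_nonneg _)) (hdom k j)
  have hmass : ∀ k, (S k).mass ≤ 4 * R / (1 - r) * meanWeight a (S k).θ := by
    intro k
    induction k with
    | zero =>
      have : (S 0).mass = 0 := by simp [AdamState.mass, hS, adam]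
      rw [this]
      exact mul_nonneg hA meanWeight_nonneg
    | succ k ih =>
      exact adamStep_mass_le ha hR hr0 hr hη.le hητ (hv k) ih (hdom k)
  have hpot : ∀ k, η * (S (k + 1)).potential β₁ r ≤ 1 / 4 * meanWeight a (S (k + 1)).θ := by
    intro k
    have e1 := mul_le_mul_of_nonneg_left ((hdom k).potential_le hr0 hr hβ) hη.le
    rw [← massCoeff] at e1
    have e2 := mul_le_mul_of_nonneg_left (hmass (k + 1)) (mul_nonneg hη.le hc3.le)
    have e3 := mul_le_mul_of_nonneg_right hηA
      (meanWeight_nonneg (a := a) (θ := (S (k + 1)).θ))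
    linarith
  have hpot0 : ∀ k, 0 ≤ η * (S k).potential β₁ r := fun k =>
    mul_nonneg hη.le (AdamState.potential_nonneg hr0 hr hβ)
  set Ψ : ℕ → ℝ := fun k =>
    n * (meanLoss a (S (k + 1)).θ + η * (S (k + 1)).potential β₁ r) with hΨ
  have hlossΨ : ∀ k, n * meanLoss a (S (k + 1)).θ ≤ Ψ k := fun k =>
    mul_le_mul_of_nonneg_left (by linarith [hpot0 (k + 1)]) hn'.le
  have hΨpos : ∀ k, 0 < Ψ k := fun k =>
    lt_of_lt_of_le (mul_pos hn' (meanLoss_pos hn)) (hlossΨ k)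
  have hdec : ∀ k, Ψ (k + 1) ≤
      Ψ k - η * descentCoeff β₁ r * γ / 4 * (Ψ k / (1 + Ψ k)) := by
    intro k
    have hdesc := adamStep_descent ha hr0 hr h1 h12 hη.le (by linarith) (hdom k)
    rw [← hSsucc, ← descentCoeff] at hdesc
    have hG0 := meanWeight_nonneg (a := a) (θ := (S (k + 1)).θ)
    have hg := mul_le_mul_of_nonneg_left
      (mul_meanWeight_le_sum_abs_gradient (θ := (S (k + 1)).θ) hd hγ)
      (mul_nonneg hη.le hc2.le)
    have hsq := mul_le_mul_of_nonneg_right hηsq hG0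
    have hstep : meanLoss a (S (k + 1 + 1)).θ + η * (S (k + 1 + 1)).potential β₁ r ≤
        meanLoss a (S (k + 1)).θ + η * (S (k + 1)).potential β₁ r -
          η * descentCoeff β₁ r * γ / 2 * meanWeight a (S (k + 1)).θ := by
      linarith
    have hF0 : 0 < n * meanLoss a (S (k + 1)).θ := mul_pos hn' (meanLoss_pos hn)
    -- The decrease is controlled by the loss alone, so the loss must be comparable to `Ψ`; this
    -- uses `η P ≤ G / 4 ≤ f / 4`.
    have hΨF : Ψ k ≤ 2 * (n * meanLoss a (S (k + 1)).θ) := by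
      have := meanWeight_le_meanLoss (a := a) (θ := (S (k + 1)).θ)
      have := hpot k
      rw [mul_left_comm]
      exact mul_le_mul_of_nonneg_left (by linarith) hn'.le
    have hnG : Ψ k / (1 + Ψ k) / 2 ≤ n * meanWeight a (S (k + 1)).θ := by
      refine le_trans ?_ (div_one_add_le_meanWeight hn)
      have := hΨpos k
      rw [div_div, div_le_div_iff₀ (by positivity) (by positivity)]
      nlinarith
    have hc : 0 ≤ η * descentCoeff β₁ r * γ / 2 := by positivity
    have e1 := mul_le_mul_of_nonneg_left hstep hn'.le
    have e2 := mul_le_mul_of_nonneg_left hnG hc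
    simp only [hΨ] at e2 ⊢
    linarith
  -- `log 2 ≤ 1`, plus `1 / 4` for the first step and `1 / 4` for the potential.
  have hΨ0 : Ψ 0 ≤ 3 / 2 * n := by
    have e1 : meanLoss a (S 1).θ ≤ meanLoss a (S 0).θ + 1 / 4 :=
      adamStep_meanLoss_le hn ha hR (sq_nonneg r) hr2 hη.le (by linarith) (hdom 0)
    have e2 : meanLoss a (S 0).θ = Real.log 2 := meanLoss_zero hn
    have e3 := hpot 0
    have e4 := meanWeight_le_one (a := a) (θ := (S (0 + 1)).θ) hn
    have e5 := Real.log_le_sub_one_of_pos (two_pos (α := ℝ))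
    rw [mul_comm]
    refine mul_le_mul_of_nonneg_left ?_ hn'.le
    simp only [zero_add] at e3 e4 ⊢
    linarith
  refine ⟨Ψ k, hΨpos k, hlossΨ k, ?_, ?_⟩
  · have hlog := Real.log_le_sub_one_of_pos (hΨpos 0)
    have := add_log_le_of_decrease hΨpos hdec k
    linarith
  · refine le_trans (antitone_nat_of_succ_le (fun k => ?_) (Nat.zero_le k)) hΨ0
    have := hΨpos k
    have h0 : 0 ≤ η * descentCoeff β₁ r * γ / 4 * (Ψ k / (1 + Ψ k)) := by positivity
    linarith [hdec k]

end Trajectory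

/-! ### Choice of constants and the iteration count -/

lemma half_sq_le_sq_add_log {n : ℕ} (hn : 0 < n) {ε : ℝ} (hε : 0 < ε) (hε' : ε ≤ 3 / 2) :
    (n : ℝ) ^ 2 / 2 ≤ (n : ℝ) ^ 2 + Real.log (1 / (n * ε)) := by
  have hn' : (0 : ℝ) < n := by exact_mod_cast hn
  rw [one_div, Real.log_inv, Real.log_mul hn'.ne' hε.ne']
  have h1 := Real.log_le_sub_one_of_pos hn'
  have h2 := Real.log_le_sub_one_of_pos hε
  nlinarith [sq_nonneg ((n : ℝ) - 1)]

theorem mainTheorem6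
    (β₁ β₂ : ℝ) (hβ₁ : 0 ≤ β₁) (hβ : β₁ ≤ β₂) (hβ₂_pos : 0 < β₂) (hβ₂ : β₂ < 1) (H : ℝ) :
    ∃ C : ℝ, 0 < C ∧
      ∀ n : ℕ, 0 < n → ∀ γ : ℝ, 0 < γ →
        ∃ η : ℝ, 0 < η ∧ η ≤ C ∧
          ∀ (p : ℝ≥0∞), 1 ≤ p →
          ∀ (D : ℕ) (x : Fin n → EuclideanSpace ℝ (Fin D)) (y : Fin n → ℝ),
            (∀ i, y i = 1 ∨ y i = -1) →
            (∀ i, (∑ j, |x i j|) ^ 2 ≤ H) →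
            ∀ θstar : EuclideanSpace ℝ (Fin D), normalizedMargin p x y θstar = γ →
            ∀ m₀ : EuclideanSpace ℝ (Fin D),
              (m₀ = gradient (logisticLoss x y) 0 ∨ m₀ = 0) →
              ∀ ε : ℝ, 0 < ε →
                ∀ T : ℕ, C / γ ^ 2 * ((n : ℝ) ^ 2 + Real.log (1 / ((n : ℝ) * ε))) ≤ (T : ℝ) →
                  logisticLoss x y (adam (logisticLoss x y) β₁ β₂ η 0 0 m₀ T).θ ≤ ε := by
  obtain ⟨r, hr0, rfl⟩ : ∃ r : ℝ, 0 < r ∧ r ^ 2 = β₂ :=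
    ⟨√β₂, Real.sqrt_pos.mpr hβ₂_pos, Real.sq_sqrt hβ₂_pos.le⟩
  have hr : r < 1 := by nlinarith
  have hβ1 : β₁ < 1 := by linarith
  have h1r : 0 < 1 - r := by linarith
  have hb : 0 < 1 - r ^ 2 := by linarith
  have hc3 := massCoeff_pos hr0 hr hβ1
  have hc2 := descentCoeff_pos hr0 hr hβ1
  set R := 1 + |H| with hR_def
  have hR1 : 1 ≤ R := by linarith [abs_nonneg H]
  have hR : 0 < R := by linarith
  set B := 1 / (1 - r ^ 2) with hB
  have hB0 : 0 < B := by positivity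
  set A := 4 * R / (1 - r) with hA_def
  have hA : 0 < A := by positivity
  obtain ⟨q, hq, hq1, hq2, hq3⟩ : ∃ q : ℝ, 0 < q ∧ q * (R * B * R) ≤ (1 - r) / 8 ∧
      q * (massCoeff β₁ r * A * R) ≤ 1 / 4 ∧ q * (R * B) ^ 2 ≤ descentCoeff β₁ r / 2 := by
    refine ⟨min ((1 - r) / 8 / (R * B * R)) (min (1 / 4 / (massCoeff β₁ r * A * R))
      (descentCoeff β₁ r / 2 / (R * B) ^ 2)), by positivity, ?_, ?_, ?_⟩
    · rw [← le_div_iff₀ (by positivity)]; exact min_le_left _ _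
    · rw [← le_div_iff₀ (by positivity)]
      exact (min_le_right _ _).trans (min_le_left _ _)
    · rw [← le_div_iff₀ (by positivity)]
      exact (min_le_right _ _).trans (min_le_right _ _)
  set c := q * descentCoeff β₁ r / 4 with hc_def
  have hc : 0 < c := by positivity
  -- The first summand bounds the step-size, the second gives the iteration count.
  refine ⟨q * R + (7 + 2 * (c * R ^ 2)) / c, by positivity, fun n hn γ hγ0 => ?_⟩
  -- A step-size is required even for `γ > R`, which no data attain; the minimum keeps it bounded
  -- and is `γ` otherwise.
  refine ⟨q * min γ R, mul_pos hq (lt_min hγ0 hR), ?_, ?_⟩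
  · have h1 : q * min γ R ≤ q * R := mul_le_mul_of_nonneg_left (min_le_right _ _) hq.le
    have h2 : 0 ≤ (7 + 2 * (c * R ^ 2)) / c := by positivity
    linarith
  intro p hp D x y hy hx θstar hmargin m₀ hm₀ ε hε T hT
  obtain ⟨d, hd, hγ⟩ := exists_direction_of_normalizedMargin hp hγ0 hmargin
  rw [logisticLoss_eq_meanLoss] at hm₀ ⊢
  set a : Fin n → Fin D → ℝ := fun i j => y i * x i j with ha_def
  have ha : ∀ i, ∑ j, |a i j| ≤ R := by
    intro i
    have e : ∑ j, |a i j| = ∑ j, |x i j| := by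
      refine Finset.sum_congr rfl fun j _ => ?_
      rcases hy i with h | h <;> simp [ha_def, h]
    rw [e]
    have := hx i
    have := le_abs_self H
    nlinarith [sq_nonneg (∑ j, |x i j| - 1)]
  have hγR : γ ≤ R := by
    have := le_of_abs_le (abs_sum_mul_le (ha ⟨0, hn⟩) zero_le_one hd)
    linarith [hγ ⟨0, hn⟩]
  rw [min_eq_left hγR]
  have hn' : (0 : ℝ) < n := by exact_mod_cast hn
  have hn1 : (1 : ℝ) ≤ n := by exact_mod_cast hn
  have main := adam_add_log_le (η := q * γ) hn ha hR.le hr0 hr hβ₁ hβ (mul_pos hq hγ0) hγ0 hd hγ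
    (by
      rw [← hB]
      refine le_trans ?_ hq1
      have := mul_le_mul_of_nonneg_left hγR (by positivity : 0 ≤ q * (R * B))
      linarith)
    (by
      rw [← hA_def]
      refine le_trans ?_ hq2
      have := mul_le_mul_of_nonneg_left hγR (by positivity : 0 ≤ q * (massCoeff β₁ r * A))
      linarith)
    (by
      rw [← hB]
      have := mul_le_mul_of_nonneg_right hq3 (by positivity : 0 ≤ q * γ ^ 2)
      linarith)
    hm₀
  -- For large `ε` the iteration bound may be negative and carry no information, but the loss never
  -- exceeds `3 / 2`.
  rcases le_or_gt (3 / 2) ε with hlarge | hsmall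
  · refine le_trans ?_ hlarge
    cases T with
    | zero =>
      have e5 := Real.log_le_sub_one_of_pos (two_pos (α := ℝ))
      exact (meanLoss_zero hn).le.trans (by linarith)
    | succ k =>
      obtain ⟨Ψ, -, hle, -, hΨ⟩ := main k
      refine le_of_mul_le_mul_left ?_ hn'
      linarith
  have hL := half_sq_le_sq_add_log hn hε hsmall.le
  set L := Real.log (1 / ((n : ℝ) * ε)) with hL_def
  have hX : 0 < (n : ℝ) ^ 2 + L := by
    have : 0 < (n : ℝ) ^ 2 / 2 := by positivity
    linarith
  have hT' : (7 + 2 * (c * R ^ 2)) * ((n : ℝ) ^ 2 + L) ≤ c * γ ^ 2 * T := by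
    have e1 : (7 + 2 * (c * R ^ 2)) / c / γ ^ 2 * ((n : ℝ) ^ 2 + L) ≤ T := by
      refine le_trans (mul_le_mul_of_nonneg_right ?_ hX.le) hT
      exact div_le_div_of_nonneg_right (by linarith [mul_pos hq hR]) (sq_nonneg γ)
    have e2 := mul_le_mul_of_nonneg_left e1 (by positivity : 0 ≤ c * γ ^ 2)
    refine le_trans (le_of_eq ?_) e2
    field_simp
  cases T with
  | zero =>
    have : 0 < (7 + 2 * (c * R ^ 2)) * ((n : ℝ) ^ 2 + L) := by positivity
    simp only [Nat.cast_zero, mul_zero] at hT'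
    linarith
  | succ k =>
    obtain ⟨Ψ, hpos, hle, hlog, -⟩ := main k
    have hrate : q * γ * descentCoeff β₁ r * γ / 4 = c * γ ^ 2 := by rw [hc_def]; ring
    rw [hrate] at hlog
    push_cast at hT'
    -- With `T = k + 1` only `k` decreases are available; the `2 c R²` in the constant absorbs the
    -- lost `c γ²`. The remaining `7 (n² + L)` exceeds `3 n + L`.
    have hγsq : c * γ ^ 2 ≤ c * R ^ 2 :=
      mul_le_mul_of_nonneg_left (pow_le_pow_left₀ hγ0.le hγR 2) hc.le
    have hnn : (n : ℝ) ≤ n ^ 2 := by nlinarith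
    have hX1 : 1 ≤ 2 * ((n : ℝ) ^ 2 + L) := by linarith
    have hcX := mul_le_mul_of_nonneg_left hX1 (by positivity : 0 ≤ c * R ^ 2)
    have hlogΨ : Real.log Ψ ≤ Real.log (n * ε) := by
      have : Real.log (n * ε) = -L := by rw [hL_def, one_div, Real.log_inv, neg_neg]
      rw [this]
      linarith [sq_nonneg (n : ℝ)]
    have := (Real.log_le_log_iff hpos (mul_pos hn' hε)).mp hlogΨ
    exact le_of_mul_le_mul_left (hle.trans this) hn'
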